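/- Let $n,p$ be nonnegative integers. Let $\mathcal E$ be the class of all laws $P$ of $(X,Y(1),Y(0),T)$ with $X\in\mathbb R^p$, $Y(1),Y(0)\in\mathbb R$, $T\in\{0,1\}$, such that at least one coordinate of $X$ has a law absolutely continuous with respect to one-dimensional Lebesgue measure, and $Y(1)$ and $Y(0)$ each have a continuous (atomless) distribution. Put $$\mathcal P_{\mathrm{SI}}=\{P\in\mathcal E:(Y(1),Y(0))\perp T\mid X\},\qquad e_P(X)=P(T=1\mid X),$$ $$\mathcal P_{\mathrm{SI}}^{\mathrm{ov}}=\{P\in\mathcal P_{\mathrm{SI}}:0<e_P(X)<1\text{ a.s.}\},$$ $$\mathcal P_{\mathrm{SI}}^{(r)}=\{P\in\mathcal P_{\mathrm{SI}}:\mathbb E_P[e_P(X)^{-r}(1-e_P(X))^{-r}]<\infty\}\quad(r\in(0,\infty)),$$ $$\mathcal P_{\mathrm{SI}}^{\mathrm{str}}=\{P\in\mathcal P_{\mathrm{SI}}:e_P(X)\in[c_P,1-c_P]\text{ a.s. for some }c_P>0\}.$$ Let $\Delta=Y(1)-Y(0)$ and let $\widehat C_{n,\alpha}$ be a (possibly randomized)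 prediction set, that is, a map $x\mapsto\widehat C_{n,\alpha}(x)$ from $\mathbb R^p$ to the Borel subsets of $\mathbb R$ constructed from the observed data $(X_i,T_i,Y_i)_{i=1}^n$, where $Y_i=T_iY_i(1)+(1-T_i)Y_i(0)$, and possibly from auxiliary randomness that is independent of all data and whose law does not depend on $P$; assume that $\mathbf 1\{y\in\widehat C_{n,\alpha}(x)\}$ is jointly measurable in the observed data, the auxiliary randomness, $x$ and $y$. Below, $\mathbb P_P$ and $\mathbb E_P$ refer to $n$ i.i.d. units from $P$, an independent new unit from $P$ with covariates $X$ and effect $\Delta$, and the auxiliary randomness; $\mathrm{length}$ is Lebesgue measure. **Theorem.** Let $\mathcal P$ be any one of $\mathcal P_{\mathrm{SI}}^{\mathrm{ov}}$, $\mathcal P_{\mathrm{SI}}^{(r)}$ (for some $r\in(0,\infty)$), $\mathcal P_{\mathrm{SI}}^{\mathrm{str}}$, and suppose that for some $\alpha\in(0,1)$ $$\sup_{P\in\mathcal P}\mathbb P_P\bigl(\Delta\notin\widehat C_{n,\alpha}(X)\bigr)\le\alpha.$$ Then, for every $P\in\mathcal P_{\mathrm{SI}}$ and every $y\in\mathbb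 R$, $$\mathbb P_P\bigl(y\notin\widehat C_{n,\alpha}(X)\bigr)\le\alpha,$$ and consequently, for every $P\in\mathcal P_{\mathrm{SI}}$, $\mathbb E_P\bigl[\mathrm{length}(\widehat C_{n,\alpha}(X))\bigr]=\infty$. -/

import Mathlib

open MeasureTheory ProbabilityTheory

namespace ITE

/-- Full data of one unit: `(X, (Y(1), Y(0)), T)` with `X ∈ ℝ^p` and `T` binary. -/
abbrev FullData (p : ℕ) : Type := (Fin p → ℝ) × (ℝ × ℝ) × Bool

/-- Observed data of one unit: `(X, T, Y)`. -/
abbrev ObsData (p : ℕ) : Type := (Fin p → ℝ) × Bool × ℝ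

variable {p : ℕ}

/-- The covariates `X`. -/
def cov (z : FullData p) : Fin p → ℝ := z.1

/-- The pair of potential outcomes `(Y(1), Y(0))`. -/
def outcomes (z : FullData p) : ℝ × ℝ := z.2.1

/-- The potential outcome `Y(1)`. -/
def y1 (z : FullData p) : ℝ := z.2.1.1

/-- The potential outcome `Y(0)`. -/
def y0 (z : FullData p) : ℝ := z.2.1.2

/-- The treatment indicator `T`. -/
def treat (z : FullData p) : Bool := z.2.2

/-- The individual treatment effect `Δ = Y(1) - Y(0)`. -/
def effect (z : FullData p) : ℝ := y1 z - y0 z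

/-- The observed part `(X, T, Y)` of a unit, with `Y = T Y(1) + (1 - T) Y(0)`. -/
def observe (z : FullData p) : ObsData p :=
  (cov z, treat z, if treat z = true then y1 z else y0 z)

theorem measurable_cov : Measurable (cov : FullData p → Fin p → ℝ) := measurable_fst

/-- The class `ℰ` of laws of `(X, Y(1), Y(0), T)` for which some coordinate of `X` is absolutely
continuous with respect to Lebesgue measure and `Y(1)`, `Y(0)` are continuously distributed
(each has a law without atoms, that is, a continuous distribution function). -/
def classE (p : ℕ) : Set (ProbabilityMeasure (FullData p)) :=
  {P | (∃ j : Fin p, (P : Measure (FullData p)).map (fun z => cov z j) ≪ volume) ∧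
    NullSingletonClass ((P : Measure (FullData p)).map y1) ∧
    NullSingletonClass ((P : Measure (FullData p)).map y0)}

/-- The strong-ignorability class: laws in `ℰ` with `(Y(1), Y(0)) ⟂ T ∣ X`. -/
def classSI (p : ℕ) : Set (ProbabilityMeasure (FullData p)) :=
  {P | P ∈ classE p ∧
    CondIndepFun (MeasurableSpace.comap cov inferInstance) measurable_cov.comap_le
      outcomes treat (P : Measure (FullData p))}

/-- The propensity score `e_P(X) = P(T = 1 ∣ X)`, as a random variable (a conditional
expectation with respect to `σ(X)`, determined almost surely). -/
noncomputable def propensity (P : ProbabilityMeasure (FullData p)) : FullData p → ℝ :=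
  condExp (MeasurableSpace.comap cov inferInstance) (P : Measure (FullData p))
    (Set.indicator {z | treat z = true} (fun _ => (1 : ℝ)))

/-- Weak overlap: `0 < e_P(X) < 1` almost surely. -/
def classOv (p : ℕ) : Set (ProbabilityMeasure (FullData p)) :=
  {P | P ∈ classSI p ∧
    ∀ᵐ z ∂(P : Measure (FullData p)), 0 < propensity P z ∧ propensity P z < 1}

/-- Moment overlap: `E_P[e_P(X)^{-r} (1 - e_P(X))^{-r}] < ∞`. The integrand is
extended-real-valued, with `0^{-r} = ∞` for `r > 0`. -/
def classMoment (p : ℕ) (r : ℝ) : Set (ProbabilityMeasure (FullData p)) :=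
  {P | P ∈ classSI p ∧
    ∫⁻ z, ENNReal.ofReal (propensity P z) ^ (-r) * ENNReal.ofReal (1 - propensity P z) ^ (-r)
      ∂(P : Measure (FullData p)) < ⊤}

/-- Strong overlap: `e_P(X) ∈ [c, 1 - c]` almost surely for some `c > 0` depending on `P`. -/
def classStr (p : ℕ) : Set (ProbabilityMeasure (FullData p)) :=
  {P | P ∈ classSI p ∧ ∃ c : ℝ, 0 < c ∧
    ∀ᵐ z ∂(P : Measure (FullData p)), propensity P z ∈ Set.Icc c (1 - c)}

/-- A (possibly randomized) prediction set built from `n` observed units. The first argument is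
the auxiliary randomness; a nonrandomized set is one that ignores it. The indicator of
`y ∈ Ĉ(x)` is jointly measurable in all arguments. -/
structure PredictionSet (Ω : Type*) [MeasurableSpace Ω] (n p : ℕ) where
  /-- The set `Ĉ(x)` computed from the auxiliary randomness, the observed sample and `x`. -/
  toSet : Ω → (Fin n → ObsData p) → (Fin p → ℝ) → Set ℝ
  measurableSet_graph :
    MeasurableSet {w : Ω × (Fin n → ObsData p) × (Fin p → ℝ) × ℝ | w.2.2.2 ∈ toSet w.1 w.2.1 w.2.2.1}

variable {Ω : Type*} [MeasurableSpace Ω] {n : ℕ}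

/-- The joint law of the auxiliary randomness, `n` i.i.d. units and an independent new unit. -/
noncomputable def experiment (ν : Measure Ω) (n : ℕ) (P : ProbabilityMeasure (FullData p)) :
    Measure (Ω × (Fin n → FullData p) × FullData p) :=
  ν.prod ((Measure.pi fun _ : Fin n => (P : Measure (FullData p))).prod
    (P : Measure (FullData p)))

/-- The realized set `Ĉ(X)` at the covariates of the new unit. -/
def PredictionSet.atNew (C : PredictionSet Ω n p) (w : Ω × (Fin n → FullData p) × FullData p) :
    Set ℝ :=
  C.toSet w.1 (fun i => observe (w.2.1 i)) (cov w.2.2)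

/-- `ℙ_P(Δ ∉ Ĉ(X))`. -/
noncomputable def PredictionSet.missEffect (C : PredictionSet Ω n p) (ν : Measure Ω)
    (P : ProbabilityMeasure (FullData p)) : ENNReal :=
  experiment ν n P {w | effect w.2.2 ∉ C.atNew w}

/-- `ℙ_P(y ∉ Ĉ(X))` for a fixed real number `y`. -/
noncomputable def PredictionSet.missPoint (C : PredictionSet Ω n p) (ν : Measure Ω)
    (P : ProbabilityMeasure (FullData p)) (y : ℝ) : ENNReal :=
  experiment ν n P {w | y ∉ C.atNew w}

/-- `E_P[length(Ĉ(X))]`, with values in `[0, ∞]`. -/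
noncomputable def PredictionSet.expectedLength (C : PredictionSet Ω n p) (ν : Measure Ω)
    (P : ProbabilityMeasure (FullData p)) : ENNReal :=
  ∫⁻ w, volume (C.atNew w) ∂(experiment ν n P)

/-- Finite-sample distribution-free validity at level `1 - α` over the class `𝓟`. -/
def PredictionSet.FiniteSampleValid (C : PredictionSet Ω n p) (ν : Measure Ω)
    (𝓟 : Set (ProbabilityMeasure (FullData p))) (α : ℝ) : Prop :=
  (⨆ P ∈ 𝓟, C.missEffect ν P) ≤ ENNReal.ofReal α

end ITE

/-! The observed data never show both potential outcomes of a unit. Moreover, as long as the units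
have distinct covariates, a randomized treatment looks exactly like one that is a function of `X`,
chosen at random. Hence any law can be imitated by laws under which the effect is constantly `y`,
and validity for those laws forces `y` into the prediction set.

Cut the covariate space into finitely many cells and give each cell `c` an independent label, equal
to `b` with probability `labelProb P k c b`. For a labelling `A`, `labelDensity` reweights `P` so
that treatment equals the label of the cell. Averaged over `A`, the `(n+1)`-fold products of these
laws agree with that of `P` on the event that all units lie in distinct cells
(`sum_prod_labels_eq_one`). Under a single reweighted law treatment is a function of `X`, so
ignorability is automatic, and `fillOutcome` rewrites the unseen outcome to make the effect `y`
without changing the observed data. Reversing treatment with probability `ε` then gives strong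
overlap (`noisyTreat_mem_classStr`) at the cost of a factor `(1 - ε)^(n+1)`. Validity bounds the
miss probability of `y` for each `A` (`missEvent_labelDensity_le`).

It remains to average over `A`, let `ε → 0` and refine the cells: one coordinate of `X` has no
atoms, so the units are eventually separated (`missPoint_le`). Infinite expected length follows by
Tonelli. -/

namespace ITE

/-! ### Product measures: densities, domination, absence of ties. -/

section ProductMeasures

variable {α : Type*} [MeasurableSpace α]

theorem pi_withDensity {ι : Type*} [Fintype ι] (μ : Measure α) [IsProbabilityMeasure μ]
    {f : α → ENNReal} (hf : Measurable f) [SigmaFinite (μ.withDensity f)] :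
    Measure.pi (fun _ : ι => μ.withDensity f) =
      (Measure.pi fun _ : ι => μ).withDensity fun z => ∏ i, f (z i) := by
  refine (Measure.pi_eq fun s hs => ?_)
  have hS : MeasurableSet (Set.univ.pi s) := MeasurableSet.univ_pi hs
  have hind : iIndepFun (fun i (z : ι → α) => (s i).indicator f (z i))
      (Measure.pi fun _ : ι => μ) :=
    iIndepFun_pi fun i => (hf.indicator (hs i)).aemeasurable
  rw [withDensity_apply _ hS, ← lintegral_indicator hS]
  have hprod : ∀ z : ι → α, (Set.univ.pi s).indicator (fun z => ∏ i, f (z i)) z =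
      ∏ i, (s i).indicator f (z i) := by
    intro z
    by_cases hz : z ∈ Set.univ.pi s
    · rw [Set.indicator_of_mem hz]
      exact Finset.prod_congr rfl fun i _ =>
        (Set.indicator_of_mem (hz i (Set.mem_univ i)) f).symm
    · rw [Set.indicator_of_notMem hz]
      obtain ⟨i, hi⟩ : ∃ i, z i ∉ s i := by simpa [Set.mem_univ_pi] using hz
      exact (Finset.prod_eq_zero (Finset.mem_univ i) (Set.indicator_of_notMem hi f)).symm
  simp_rw [hprod]
  rw [lintegral_prod_eq_prod_lintegral_of_indepFun Finset.univ _ hind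
    fun i => (hf.indicator (hs i)).comp (measurable_pi_apply i)]
  refine Finset.prod_congr rfl fun i _ => ?_
  rw [withDensity_apply _ (hs i), ← lintegral_indicator (hs i)]
  exact (measurePreserving_eval (fun _ : ι => μ) i).lintegral_comp (hf.indicator (hs i))

/-- Carries the one-unit bound `(1 - ε) • S ≤ noisyTreat ε S` over to whole samples. -/
theorem pi_mono {n : ℕ} {μ μ' : Measure α} [IsFiniteMeasure μ] [IsFiniteMeasure μ']
    (h : μ ≤ μ') :
    Measure.pi (fun _ : Fin n => μ) ≤ Measure.pi fun _ : Fin n => μ' := by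
  induction n with
  | zero => rw [Measure.pi_of_empty, Measure.pi_of_empty]
  | succ n ih =>
    rw [← (measurePreserving_piFinSuccAbove (fun _ : Fin (n + 1) => μ) 0).symm.map_eq,
      ← (measurePreserving_piFinSuccAbove (fun _ : Fin (n + 1) => μ') 0).symm.map_eq]
    exact Measure.map_mono (Measure.prod_mono h ih) (MeasurableEquiv.measurable _)

theorem pi_smul {n : ℕ} (μ : Measure α) [IsFiniteMeasure μ] {c : ENNReal} (hc : c ≠ ⊤) :
    Measure.pi (fun _ : Fin n => c • μ) = c ^ n • Measure.pi fun _ : Fin n => μ := by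
  have := Measure.smul_finite μ hc
  refine Measure.pi_eq fun s _ => ?_
  simp [Measure.pi_pi, Finset.prod_mul_distrib]

/-- Independent draws from a law without atoms are almost surely distinct. -/
theorem ae_injective_pi {ι β : Type*} [Fintype ι] [MeasurableSpace β]
    [MeasurableEq β] (μ : Measure α) [IsProbabilityMeasure μ] {g : α → β} (hg : Measurable g)
    [hna : NullSingletonClass (μ.map g)] :
    ∀ᵐ z ∂Measure.pi (fun _ : ι => μ), Function.Injective fun i => g (z i) := by
  have hdiag : MeasurableSet {q : β × β | q.1 = q.2} := measurableSet_diagonal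
  have key : ∀ i k : ι, i ≠ k → ∀ᵐ z ∂Measure.pi (fun _ : ι => μ), g (z i) ≠ g (z k) := by
    intro i k hik
    have hind : IndepFun (fun z : ι → α => g (z i)) (fun z => g (z k))
        (Measure.pi fun _ : ι => μ) :=
      (iIndepFun_pi (X := fun _ : ι => g) (μ := fun _ : ι => μ)
        fun _ => hg.aemeasurable).indepFun hik
    have hmap : ∀ i : ι, (Measure.pi fun _ : ι => μ).map (fun z => g (z i)) = μ.map g := by
      intro i
      have := Measure.map_map (μ := Measure.pi fun _ : ι => μ) hg (measurable_pi_apply i)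
      rw [(measurePreserving_eval (fun _ : ι => μ) i).map_eq] at this
      exact this.symm
    have hgi : ∀ i : ι, Measurable fun z : ι → α => g (z i) :=
      fun i => hg.comp (measurable_pi_apply i)
    have hjoint := (indepFun_iff_map_prod_eq_prod_map_map (hgi i).aemeasurable
      (hgi k).aemeasurable).1 hind
    rw [hmap, hmap] at hjoint
    have : IsProbabilityMeasure (μ.map g) := Measure.isProbabilityMeasure_map hg.aemeasurable
    -- Every slice of the diagonal is a single point, hence null.
    have hz : ((μ.map g).prod (μ.map g)) {q : β × β | q.1 = q.2} = 0 := by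
      rw [Measure.measure_prod_null hdiag]
      refine Filter.Eventually.of_forall fun x => ?_
      have : Prod.mk x ⁻¹' {q : β × β | q.1 = q.2} = {x} := by
        ext; simp [eq_comm]
      simp [this]
    rw [← hjoint, Measure.map_apply ((hgi i).prodMk (hgi k)) hdiag] at hz
    rw [ae_iff]
    simpa using hz
  have hall : ∀ᵐ z ∂Measure.pi (fun _ : ι => μ), ∀ i k : ι, i ≠ k → g (z i) ≠ g (z k) := by
    simp only [ae_all_iff]
    exact key
  filter_upwards [hall] with z hz i k hik
  by_contra hne
  exact hz i k hne hik

end ProductMeasures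

/-! ### The label-averaging identity and a criterion for conditional probabilities. -/

/-- Averaging `∏ i, 1{A (k i) = t i} / w (k i) (t i)` over independent labels `A c ∼ w c` gives
`1` when the `k i` are distinct. -/
theorem sum_prod_labels_eq_one {κ ι : Type*} [Fintype κ] [DecidableEq κ] [Fintype ι]
    (w : κ → Bool → ENNReal) (hw : ∀ c, ∑ b, w c b = 1) (k : ι → κ) (hk : Function.Injective k)
    (t : ι → Bool) (ht : ∀ i, w (k i) (t i) ≠ 0) :
    ∑ A : κ → Bool, (∏ c, w c (A c)) *
      ∏ i, (if t i = A (k i) then (w (k i) (A (k i)))⁻¹ else 0) = 1 := by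
  classical
  have hle : ∀ c b, w c b ≤ 1 := fun c b => by
    rw [← hw c]; exact Finset.single_le_sum (f := w c) (fun _ _ => zero_le) (Finset.mem_univ b)
  -- `h c b` gathers all factors that involve the label of `c`, so the sum over labellings becomes a
  -- product over cells of two-term sums. Injectivity leaves at most one unit per cell: an occupied
  -- cell contributes `w * w⁻¹ = 1` from the matching label only, an empty one contributes the total
  -- weight `1`.
  let h : κ → Bool → ENNReal := fun c b =>
    w c b * ∏ i with k i = c, (if t i = b then (w c b)⁻¹ else 0)
  have h1 : ∀ A : κ → Bool, (∏ c, w c (A c)) *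
      ∏ i, (if t i = A (k i) then (w (k i) (A (k i)))⁻¹ else 0) = ∏ c, h c (A c) := by
    intro A
    rw [Finset.prod_mul_distrib, ← Finset.prod_fiberwise Finset.univ k]
    congr 1
    refine Finset.prod_congr rfl fun c _ => Finset.prod_congr rfl fun i hi => ?_
    rw [(Finset.mem_filter.1 hi).2]
  simp_rw [h1]
  rw [← Fintype.prod_sum]
  refine Finset.prod_eq_one fun c _ => ?_
  by_cases hc : ∃ i, k i = c
  · obtain ⟨i, rfl⟩ := hc
    have hf : Finset.univ.filter (fun l => k l = k i) = {i} := by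
      ext l; simp [hk.eq_iff]
    have : ∀ b, h (k i) b = if t i = b then 1 else 0 := by
      intro b
      simp only [h, hf, Finset.prod_singleton]
      split_ifs with hb
      · subst hb
        exact ENNReal.mul_inv_cancel (ht i) ((hle _ _).trans_lt ENNReal.one_lt_top).ne
      · simp
    simp [this]
  · have hf : Finset.univ.filter (fun l => k l = c) = ∅ := by
      ext l; simp; exact fun h => hc ⟨l, h⟩
    simp only [h, hf, Finset.prod_empty, mul_one]
    exact hw c

/-- The function `g` acts as the conditional probability of `T`, unaffected by further conditioning
on `W`. Pulling it out of the conditional expectation of `g * 1_W` gives the factorization behind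
conditional independence. -/
theorem condExp_inter_eq_mul {Ω : Type*} {m mΩ : MeasurableSpace Ω} (hm : m ≤ mΩ)
    (μ : Measure Ω) [IsFiniteMeasure μ] {W T : Set Ω} (hW : MeasurableSet W)
    (hT : MeasurableSet T) {g : Ω → ℝ} (hg : StronglyMeasurable[m] g) {c : ℝ}
    (hgc : ∀ ω, ‖g ω‖ ≤ c)
    (h : ∀ s, MeasurableSet[m] s → ∫ ω in s ∩ W, g ω ∂μ = μ.real (s ∩ W ∩ T)) :
    μ⟦W ∩ T | m⟧ =ᵐ[μ] fun ω => g ω * (μ⟦W | m⟧) ω := by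
  have hWi : Integrable (W.indicator fun _ => (1 : ℝ)) μ := (integrable_const 1).indicator hW
  have hgW : Integrable (g * W.indicator fun _ => (1 : ℝ)) μ :=
    hWi.bdd_mul (c := c) (hg.mono hm).aestronglyMeasurable (Filter.Eventually.of_forall hgc)
  have hpull : μ[g * (W.indicator fun _ => (1 : ℝ)) | m] =ᵐ[μ] g * μ⟦W | m⟧ :=
    condExp_mul_of_stronglyMeasurable_left hg hgW hWi
  refine Filter.EventuallyEq.trans (Filter.EventuallyEq.symm ?_) hpull
  refine ae_eq_condExp_of_forall_setIntegral_eq hm ((integrable_const 1).indicator (hW.inter hT))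
    (fun s _ _ => integrable_condExp.integrableOn) (fun s hs _ => ?_)
    stronglyMeasurable_condExp.aestronglyMeasurable
  rw [setIntegral_condExp hm hgW hs]
  have h1 : (g * W.indicator fun _ => (1 : ℝ)) = W.indicator g := by
    ext ω; by_cases hω : ω ∈ W <;> simp [hω]
  rw [h1, setIntegral_indicator hW, h s hs, setIntegral_indicator (hW.inter hT)]
  simp [Set.inter_assoc]

/-! ### Random reversal of a deterministic treatment. -/

variable {p : ℕ}

/-- Reverse the treatment indicator. -/
def flipTreat (z : FullData p) : FullData p := (z.1, z.2.1, !z.2.2)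

theorem measurable_outcomes : Measurable (outcomes : FullData p → ℝ × ℝ) :=
  measurable_fst.comp measurable_snd

theorem measurable_y1 : Measurable (y1 : FullData p → ℝ) := measurable_fst.comp measurable_outcomes

theorem measurable_y0 : Measurable (y0 : FullData p → ℝ) := measurable_snd.comp measurable_outcomes

theorem measurable_treat : Measurable (treat : FullData p → Bool) :=
  measurable_snd.comp measurable_snd

theorem measurable_flipTreat : Measurable (flipTreat : FullData p → FullData p) := by
  unfold flipTreat
  exact measurable_fst.prodMk ((measurable_fst.comp measurable_snd).prodMk
    ((measurable_of_finite not).comp measurable_treat))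

/-- The law obtained from `S` by reversing the treatment indicator with probability `ε`. -/
noncomputable def noisyTreat (ε : ℝ) (S : Measure (FullData p)) : Measure (FullData p) :=
  ENNReal.ofReal (1 - ε) • S + ENNReal.ofReal ε • S.map flipTreat

/-- The conditional probability of `treat ∈ V` under `noisyTreat ε S` when `treat = lab X` under
`S`. -/
noncomputable def noisyProb (ε : ℝ) (lab : (Fin p → ℝ) → Bool) (V : Set Bool) (z : FullData p) :
    ℝ :=
  (1 - ε) * V.indicator 1 (lab (cov z)) + ε * V.indicator 1 (!lab (cov z))

section Noisy

variable {ε : ℝ} {S : Measure (FullData p)}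

theorem isProbabilityMeasure_noisyTreat [IsProbabilityMeasure S] (h0 : 0 ≤ ε) (h1 : ε ≤ 1) :
    IsProbabilityMeasure (noisyTreat ε S) := by
  have := Measure.isProbabilityMeasure_map (μ := S) measurable_flipTreat.aemeasurable
  constructor
  simp only [noisyTreat, Measure.add_apply, Measure.smul_apply, measure_univ, smul_eq_mul, mul_one]
  rw [← ENNReal.ofReal_add (by linarith) h0]
  simp

/-- Events that ignore the treatment keep their mass, so the laws of covariates, outcomes and effect
pass unchanged from `S`. -/
theorem noisyTreat_apply_of_invariant (h0 : 0 ≤ ε) (h1 : ε ≤ 1) {W : Set (FullData p)}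
    (hW : MeasurableSet W) (hinv : flipTreat ⁻¹' W = W) : noisyTreat ε S W = S W := by
  simp only [noisyTreat, Measure.add_apply, Measure.smul_apply, smul_eq_mul]
  rw [Measure.map_apply measurable_flipTreat hW, hinv, ← add_mul,
    ← ENNReal.ofReal_add (by linarith) h0]
  simp

theorem setIntegral_noisyTreat [IsFiniteMeasure S] (h0 : 0 ≤ ε) (h1 : ε ≤ 1)
    {W : Set (FullData p)} (hW : MeasurableSet W) (hinv : flipTreat ⁻¹' W = W)
    {F : FullData p → ℝ} (hF : Measurable F) {c : ℝ} (hc : ∀ z, ‖F z‖ ≤ c) :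
    ∫ z in W, F z ∂noisyTreat ε S =
      (1 - ε) * ∫ z in W, F z ∂S + ε * ∫ z in W, F (flipTreat z) ∂S := by
  have hb : ∀ μ : Measure (FullData p), IsFiniteMeasure μ → Integrable F μ := fun μ _ =>
    Integrable.of_bound hF.aestronglyMeasurable c (Filter.Eventually.of_forall hc)
  have hm : IsFiniteMeasure (S.map flipTreat) := inferInstance
  rw [noisyTreat, Measure.restrict_add, Measure.restrict_smul, Measure.restrict_smul,
    integral_add_measure ((hb _ inferInstance).smul_measure ENNReal.ofReal_ne_top)
      ((hb _ inferInstance).smul_measure ENNReal.ofReal_ne_top),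
    integral_smul_measure, integral_smul_measure,
    setIntegral_map hW hF.aestronglyMeasurable measurable_flipTreat.aemeasurable, hinv,
    ENNReal.toReal_ofReal (by linarith), ENNReal.toReal_ofReal h0, smul_eq_mul, smul_eq_mul]

variable {lab : (Fin p → ℝ) → Bool} {V : Set Bool}

theorem norm_noisyProb_le (h0 : 0 ≤ ε) (h1 : ε ≤ 1) (z : FullData p) :
    ‖noisyProb ε lab V z‖ ≤ 1 := by
  classical
  rw [Real.norm_eq_abs, abs_le]
  unfold noisyProb
  simp only [Set.indicator_apply, Pi.one_apply]
  constructor <;> split_ifs <;> linarith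

theorem stronglyMeasurable_noisyProb (hlab : Measurable lab) :
    StronglyMeasurable[MeasurableSpace.comap cov inferInstance]
      (noisyProb ε lab V : FullData p → ℝ) := by
  have hG : Measurable fun b : Bool =>
      (1 - ε) * V.indicator (1 : Bool → ℝ) b + ε * V.indicator 1 (!b) := measurable_of_finite _
  exact ((hG.comp hlab).comp (comap_measurable cov)).stronglyMeasurable

/-- Under `S` the treatment is `lab X`, and after reversal it is the opposite. Both sides are
therefore the same `(1 - ε, ε)` combination of integrals over `S`, since `noisyProb` depends on the
covariates alone. -/
theorem setIntegral_noisyProb [IsFiniteMeasure S] (h0 : 0 ≤ ε) (h1 : ε ≤ 1)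
    (hlab : Measurable lab) (hS : ∀ᵐ z ∂S, treat z = lab (cov z))
    {W : Set (FullData p)} (hW : MeasurableSet W) (hinv : flipTreat ⁻¹' W = W) :
    ∫ z in W, noisyProb ε lab V z ∂noisyTreat ε S =
      (noisyTreat ε S).real (W ∩ treat ⁻¹' V) := by
  have hV : MeasurableSet V := V.toFinite.measurableSet
  have hTV : MeasurableSet (treat ⁻¹' V : Set (FullData p)) := measurable_treat hV
  have hi : ∀ z : FullData p, ‖(V.indicator 1 (treat z) : ℝ)‖ ≤ 1 := fun z => by
    classical
    simp only [Set.indicator_apply, Pi.one_apply]; split_ifs <;> simp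
  have hl : (noisyTreat ε S).real (W ∩ treat ⁻¹' V) =
      ∫ z in W, (V.indicator 1 (treat z) : ℝ) ∂noisyTreat ε S := by
    have : (fun z : FullData p => (V.indicator 1 (treat z) : ℝ)) =
        (treat ⁻¹' V).indicator fun _ => (1 : ℝ) := by
      ext z; rfl
    rw [this, setIntegral_indicator hTV]
    simp
  have hmeas : ∀ φ : Bool → ℝ, Measurable fun z : FullData p => φ (lab (cov z)) := fun φ =>
    (measurable_of_finite φ).comp (hlab.comp measurable_cov)
  have hint : ∀ φ : Bool → ℝ, Integrable (fun z : FullData p => φ (lab (cov z)))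
      (S.restrict W) := fun φ =>
    Integrable.of_bound (hmeas φ).aestronglyMeasurable (|φ true| + |φ false|)
      (Filter.Eventually.of_forall fun z => by
        rw [Real.norm_eq_abs]
        cases lab (cov z)
        · linarith [abs_nonneg (φ true)]
        · linarith [abs_nonneg (φ false)])
  rw [hl, setIntegral_noisyTreat (F := fun z => V.indicator 1 (treat z)) h0 h1 hW hinv
      ((measurable_of_finite (V.indicator (1 : Bool → ℝ))).comp measurable_treat) hi,
    setIntegral_noisyTreat h0 h1 hW hinv
      ((stronglyMeasurable_noisyProb hlab).measurable.mono measurable_cov.comap_le le_rfl)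
      (norm_noisyProb_le h0 h1)]
  have e1 : ∫ z in W, (V.indicator 1 (treat z) : ℝ) ∂S =
      ∫ z in W, (V.indicator 1 (lab (cov z)) : ℝ) ∂S :=
    integral_congr_ae (by filter_upwards [ae_restrict_of_ae hS] with z hz; rw [hz])
  have e2 : ∫ z in W, (V.indicator 1 (treat (flipTreat z)) : ℝ) ∂S =
      ∫ z in W, (V.indicator 1 (!lab (cov z)) : ℝ) ∂S :=
    integral_congr_ae (by
      filter_upwards [ae_restrict_of_ae hS] with z hz
      rw [show treat (flipTreat z) = !treat z from rfl, hz])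
  have e3 : ∀ z : FullData p, noisyProb ε lab V (flipTreat z) = noisyProb ε lab V z :=
    fun _ => rfl
  simp_rw [e3]
  rw [e1, e2, ← add_mul, sub_add_cancel, one_mul]
  unfold noisyProb
  rw [integral_add ((hint fun b => V.indicator 1 b).const_mul _)
    ((hint fun b => V.indicator 1 (!b)).const_mul _), integral_const_mul, integral_const_mul]

theorem condExp_noisyTreat [IsFiniteMeasure S] [IsFiniteMeasure (noisyTreat ε S)]
    (h0 : 0 ≤ ε) (h1 : ε ≤ 1) (hlab : Measurable lab) (hS : ∀ᵐ z ∂S, treat z = lab (cov z))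
    {W : Set (FullData p)} (hW : MeasurableSet W) (hinv : flipTreat ⁻¹' W = W) :
    (noisyTreat ε S)⟦W ∩ treat ⁻¹' V | MeasurableSpace.comap cov inferInstance⟧
      =ᵐ[noisyTreat ε S] fun z => noisyProb ε lab V z *
        ((noisyTreat ε S)⟦W | MeasurableSpace.comap cov inferInstance⟧) z := by
  refine condExp_inter_eq_mul measurable_cov.comap_le _ hW
    (measurable_treat V.toFinite.measurableSet) (stronglyMeasurable_noisyProb hlab)
    (norm_noisyProb_le h0 h1) ?_
  rintro _ ⟨s, hs, rfl⟩
  refine setIntegral_noisyProb h0 h1 hlab hS ((measurable_cov hs).inter hW) ?_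
  rw [Set.preimage_inter, hinv]
  rfl

theorem condExp_treat_noisyTreat [IsFiniteMeasure S] [IsFiniteMeasure (noisyTreat ε S)]
    (h0 : 0 ≤ ε) (h1 : ε ≤ 1) (hlab : Measurable lab) (hS : ∀ᵐ z ∂S, treat z = lab (cov z)) :
    (noisyTreat ε S)⟦treat ⁻¹' V | MeasurableSpace.comap cov inferInstance⟧
      =ᵐ[noisyTreat ε S] noisyProb ε lab V := by
  have h := condExp_noisyTreat (V := V) (S := S) h0 h1 hlab hS MeasurableSet.univ rfl
  rw [Set.univ_inter, Set.indicator_univ, condExp_const measurable_cov.comap_le] at h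
  simpa using h

theorem condIndepFun_noisyTreat [IsFiniteMeasure S] [IsFiniteMeasure (noisyTreat ε S)]
    (h0 : 0 ≤ ε) (h1 : ε ≤ 1) (hlab : Measurable lab) (hS : ∀ᵐ z ∂S, treat z = lab (cov z)) :
    CondIndepFun (MeasurableSpace.comap cov inferInstance) measurable_cov.comap_le
      outcomes treat (noisyTreat ε S) := by
  rw [condIndepFun_iff_condExp_inter_preimage_eq_mul measurable_outcomes measurable_treat]
  intro U V hU _
  filter_upwards [condExp_noisyTreat (V := V) h0 h1 hlab hS (measurable_outcomes hU) rfl,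
    condExp_treat_noisyTreat (V := V) h0 h1 hlab hS] with z hz hz'
  rw [hz, hz', mul_comm]

/-- Noisy deterministic treatment assignment gives a law with strong overlap. -/
theorem noisyTreat_mem_classStr [IsProbabilityMeasure S] (h0 : 0 < ε) (h1 : ε ≤ 1 / 2)
    (hlab : Measurable lab) (hS : ∀ᵐ z ∂S, treat z = lab (cov z))
    (hcov : ∃ j : Fin p, S.map (fun z => cov z j) ≪ volume)
    (hy1 : ∀ v, S {z | y1 z = v} = 0) (hy0 : ∀ v, S {z | y0 z = v} = 0)
    (R : ProbabilityMeasure (FullData p)) (hR : (R : Measure (FullData p)) = noisyTreat ε S) :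
    R ∈ classStr p := by
  have h0' : 0 ≤ ε := h0.le
  have h1' : ε ≤ 1 := by linarith
  have := isProbabilityMeasure_noisyTreat (S := S) h0' h1'
  refine ⟨⟨⟨?_, ⟨fun v => ?_⟩, ⟨fun v => ?_⟩⟩, ?_⟩, ε, h0, ?_⟩
  · obtain ⟨j, hj⟩ := hcov
    refine ⟨j, Measure.AbsolutelyContinuous.mk fun s hs hs0 => ?_⟩
    have hm : Measurable fun z : FullData p => cov z j :=
      (measurable_pi_apply j).comp measurable_cov
    have := hj hs0
    rw [Measure.map_apply hm hs] at this ⊢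
    rwa [hR, noisyTreat_apply_of_invariant h0' h1' (hm hs) rfl]
  · rw [hR, Measure.map_apply measurable_y1 (measurableSet_singleton v),
      noisyTreat_apply_of_invariant h0' h1' (measurable_y1 (measurableSet_singleton v)) rfl]
    exact hy1 v
  · rw [hR, Measure.map_apply measurable_y0 (measurableSet_singleton v),
      noisyTreat_apply_of_invariant h0' h1' (measurable_y0 (measurableSet_singleton v)) rfl]
    exact hy0 v
  · have h := condIndepFun_noisyTreat (S := S) h0' h1' hlab hS
    convert h
  -- For `V = {true}` the value of `noisyProb` is `1 - ε` or `ε`; both lie in `[ε, 1 - ε]` because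
  -- `ε ≤ 1 / 2`.
  · have h := condExp_treat_noisyTreat (V := {true}) (S := S) h0' h1' hlab hS
    have he : propensity R =
        (noisyTreat ε S)⟦treat ⁻¹' {true} | MeasurableSpace.comap cov inferInstance⟧ := by
      unfold propensity
      rw [hR]
      rfl
    rw [he, hR]
    filter_upwards [h] with z hz
    rw [hz]
    unfold noisyProb
    cases lab (cov z) <;> simp <;> linarith

end Noisy

/-! ### Strong overlap implies the other overlap conditions. -/

theorem classStr_subset_classOv : classStr p ⊆ classOv p := by
  rintro P ⟨hP, c, hc, h⟩
  refine ⟨hP, ?_⟩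
  filter_upwards [h] with z hz
  exact ⟨hc.trans_le hz.1, by linarith [hz.2]⟩

theorem classStr_subset_classMoment {r : ℝ} (hr : 0 < r) : classStr p ⊆ classMoment p r := by
  rintro P ⟨hP, c, hc, h⟩
  refine ⟨hP, ?_⟩
  have hle : ∀ x : ℝ, c ≤ x → ENNReal.ofReal x ^ (-r) ≤ ENNReal.ofReal c ^ (-r) := fun x hx => by
    rw [ENNReal.rpow_neg, ENNReal.rpow_neg]
    exact ENNReal.inv_le_inv.2 (ENNReal.rpow_le_rpow (ENNReal.ofReal_le_ofReal hx) hr.le)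
  have hfin : ENNReal.ofReal c ^ (-r) ≠ ⊤ :=
    ENNReal.rpow_ne_top_of_ne_zero (ENNReal.ofReal_pos.2 hc).ne' ENNReal.ofReal_ne_top
  calc _ ≤ ∫⁻ _, ENNReal.ofReal c ^ (-r) * ENNReal.ofReal c ^ (-r)
        ∂(P : Measure (FullData p)) := by
        refine lintegral_mono_ae ?_
        filter_upwards [h] with z hz
        exact mul_le_mul' (hle _ hz.1) (hle _ (by linarith [hz.2]))
    _ < ⊤ := by
      rw [lintegral_const, measure_univ, mul_one]
      exact ENNReal.mul_lt_top hfin.lt_top hfin.lt_top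

/-! ### Completing the observed data with a constant effect. -/

/-- Replace the unobserved potential outcome so that the treatment effect equals `y`. -/
noncomputable def fillOutcome (y : ℝ) (z : FullData p) : FullData p :=
  (z.1, if treat z = true then (y1 z, y1 z - y) else (y0 z + y, y0 z), z.2.2)

theorem measurable_fillOutcome (y : ℝ) : Measurable (fillOutcome y : FullData p → FullData p) := by
  refine measurable_fst.prodMk (Measurable.prodMk ?_ (measurable_snd.comp measurable_snd))
  exact Measurable.ite (measurable_treat (measurableSet_singleton true))
    (measurable_y1.prodMk (measurable_y1.sub_const y))
    ((measurable_y0.add_const y).prodMk measurable_y0)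

theorem observe_fillOutcome (y : ℝ) (z : FullData p) : observe (fillOutcome y z) = observe z := by
  by_cases h : z.2.2 = true <;> simp [observe, fillOutcome, cov, treat, y1, y0, h]

theorem effect_fillOutcome (y : ℝ) (z : FullData p) : effect (fillOutcome y z) = y := by
  by_cases h : z.2.2 = true <;> simp [effect, fillOutcome, treat, y1, y0, h]

theorem measurable_observe : Measurable (observe : FullData p → ObsData p) :=
  measurable_cov.prodMk (measurable_treat.prodMk
    (Measurable.ite (measurable_treat (measurableSet_singleton true)) measurable_y1 measurable_y0))

theorem measurable_effect : Measurable (effect : FullData p → ℝ) := measurable_y1.sub measurable_y0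

/-! ### Laws with treatment determined by the cell of the covariates. -/

section Labels

variable {κ : Type*}

/-- The conditional probability of `treat = b` given that the covariates lie in the cell `c`. -/
noncomputable def labelProb (P : Measure (FullData p)) (k : (Fin p → ℝ) → κ) (c : κ) :
    Bool → ENNReal
  | true => P ((fun z => k (cov z)) ⁻¹' {c} ∩ treat ⁻¹' {true}) /
      P ((fun z => k (cov z)) ⁻¹' {c})
  -- On a null cell the quotient is `0 / 0 = 0`; taking the complement here keeps the total equal to
  -- `1` in that case too.
  | false => 1 - P ((fun z => k (cov z)) ⁻¹' {c} ∩ treat ⁻¹' {true}) /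
      P ((fun z => k (cov z)) ⁻¹' {c})

/-- The density, with respect to `P`, of the law under which the treatment of a unit is the label
`A c` of the cell `c` of its covariates. -/
noncomputable def labelDensity (P : Measure (FullData p)) (k : (Fin p → ℝ) → κ) (A : κ → Bool)
    (z : FullData p) : ENNReal :=
  if treat z = A (k (cov z)) then (labelProb P k (k (cov z)) (A (k (cov z))))⁻¹ else 0

variable (P : Measure (FullData p)) {k : (Fin p → ℝ) → κ}

theorem sum_labelProb (c : κ) : ∑ b, labelProb P k c b = 1 := by
  simp only [Fintype.sum_bool, labelProb]
  exact add_tsub_cancel_of_le (ENNReal.div_le_of_le_mul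
    (by rw [one_mul]; exact measure_mono Set.inter_subset_left))

variable [MeasurableSpace κ] [MeasurableSingletonClass κ]

theorem measurable_labelDensity [Fintype κ] (hk : Measurable k) (A : κ → Bool) :
    Measurable (labelDensity P k A) := by
  have hkc : Measurable fun z : FullData p => k (cov z) := hk.comp measurable_cov
  have h : Measurable fun q : Bool × κ =>
      if q.1 = A q.2 then (labelProb P k q.2 (A q.2))⁻¹ else 0 := measurable_of_finite _
  exact h.comp (measurable_treat.prodMk hkc)

theorem ae_treat_eq_label [Fintype κ] (hk : Measurable k) (A : κ → Bool) :
    ∀ᵐ z ∂P.withDensity (labelDensity P k A), treat z = A (k (cov z)) := by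
  rw [ae_withDensity_iff (measurable_labelDensity P hk A)]
  refine Filter.Eventually.of_forall fun z hz => ?_
  by_contra h
  exact hz (if_neg h)

variable [IsProbabilityMeasure P]

theorem measure_cell_mul_labelProb (hk : Measurable k) (c : κ) (b : Bool) :
    P ((fun z => k (cov z)) ⁻¹' {c}) * labelProb P k c b =
      P ((fun z => k (cov z)) ⁻¹' {c} ∩ treat ⁻¹' {b}) := by
  have hc : MeasurableSet ((fun z : FullData p => k (cov z)) ⁻¹' {c}) :=
    (hk.comp measurable_cov) (measurableSet_singleton c)
  have ht : P ((fun z => k (cov z)) ⁻¹' {c}) * labelProb P k c true =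
      P ((fun z => k (cov z)) ⁻¹' {c} ∩ treat ⁻¹' {true}) := by
    refine ENNReal.mul_div_cancel' (fun h => ?_) (fun h => absurd h (measure_ne_top _ _))
    exact measure_mono_null Set.inter_subset_left h
  cases b with
  | true => exact ht
  | false =>
    have hsum := sum_labelProb P (k := k) c
    rw [Fintype.sum_bool] at hsum
    have h1 : P ((fun z => k (cov z)) ⁻¹' {c} ∩ treat ⁻¹' {true}) +
        P ((fun z => k (cov z)) ⁻¹' {c}) * labelProb P k c false =
        P ((fun z => k (cov z)) ⁻¹' {c}) := by
      rw [← ht, ← mul_add, hsum, mul_one]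
    have h2 := measure_inter_add_sdiff (μ := P) ((fun z => k (cov z)) ⁻¹' {c})
      (measurable_treat (p := p) (measurableSet_singleton true))
    have h3 : (fun z : FullData p => k (cov z)) ⁻¹' {c} \ treat ⁻¹' {true} =
        (fun z => k (cov z)) ⁻¹' {c} ∩ treat ⁻¹' {false} := by
      ext z; simp
    rw [h3] at h2
    exact (ENNReal.add_right_inj (measure_ne_top _ _)).1 (h1.trans h2.symm)

theorem ae_labelProb_ne_zero [Fintype κ] (hk : Measurable k) :
    ∀ᵐ z ∂P, labelProb P k (k (cov z)) (treat z) ≠ 0 := by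
  have key : ∀ c b, ∀ᵐ z ∂P, labelProb P k c b = 0 → ¬ (k (cov z) = c ∧ treat z = b) := by
    intro c b
    by_cases h : labelProb P k c b = 0
    · have h0 := measure_cell_mul_labelProb P hk c b
      rw [h, mul_zero] at h0
      rw [ae_iff]
      convert h0.symm using 2
      ext z; simp [h]
    · exact Filter.Eventually.of_forall fun z h' => absurd h' h
  have := ae_all_iff.2 fun c => ae_all_iff.2 (key c)
  filter_upwards [this] with z hz h0
  exact hz _ _ h0 ⟨rfl, rfl⟩

/-- Each cell keeps its mass: restricting to the chosen label multiplies it by the label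
probability, and the density divides by the same number. -/
theorem isProbabilityMeasure_labelDensity [Fintype κ] (hk : Measurable k) {A : κ → Bool}
    (hA : ∀ c, labelProb P k c (A c) ≠ 0) :
    IsProbabilityMeasure (P.withDensity (labelDensity P k A)) := by
  have hle : ∀ c b, labelProb P k c b ≠ ⊤ := fun c b => by
    refine ne_top_of_le_ne_top ENNReal.one_ne_top ?_
    rw [← sum_labelProb P (k := k) c]
    exact Finset.single_le_sum (f := labelProb P k c) (fun _ _ => zero_le) (Finset.mem_univ b)
  have hms : ∀ c b, MeasurableSet ((fun z : FullData p => k (cov z)) ⁻¹' {c} ∩ treat ⁻¹' {b}) :=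
    fun c b => ((hk.comp measurable_cov) (measurableSet_singleton c)).inter
      (measurable_treat (measurableSet_singleton b))
  have hf : labelDensity P k A = fun z => ∑ c,
      ((fun z => k (cov z)) ⁻¹' {c} ∩ treat ⁻¹' {A c}).indicator
        (fun _ => (labelProb P k c (A c))⁻¹) z := by
    ext z
    rw [Finset.sum_eq_single_of_mem (k (cov z)) (Finset.mem_univ _)]
    · classical
      simp [labelDensity, Set.indicator_apply]
    · intro c _ hc
      refine Set.indicator_of_notMem (fun h => hc ?_) _
      exact (h.1 : k (cov z) = c).symm
  constructor
  rw [withDensity_apply _ MeasurableSet.univ, Measure.restrict_univ, hf,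
    lintegral_finsetSum _ fun c _ => measurable_const.indicator (hms c (A c))]
  have hterm : ∀ c, ∫⁻ z, ((fun z => k (cov z)) ⁻¹' {c} ∩ treat ⁻¹' {A c}).indicator
        (fun _ => (labelProb P k c (A c))⁻¹) z ∂P = P ((fun z => k (cov z)) ⁻¹' {c}) := by
    intro c
    rw [lintegral_indicator_const (hms c (A c)), ← measure_cell_mul_labelProb P hk c (A c),
      mul_comm, mul_assoc, ENNReal.mul_inv_cancel (hA c) (hle c _), mul_one]
  simp_rw [hterm]
  rw [sum_measure_preimage_singleton (f := fun z : FullData p => k (cov z)) _ fun c _ =>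
    (hk.comp measurable_cov) (measurableSet_singleton c)]
  simp

end Labels

/-! ### Miscoverage as an event about `n + 1` i.i.d. units. -/

variable {n : ℕ} {Ω : Type*} [MeasurableSpace Ω]

/-- The event `y ∉ Ĉ(X)`, with the new unit listed last in the sample. -/
def missEvent (C : PredictionSet Ω n p) (y : ℝ) : Set (Ω × (Fin (n + 1) → FullData p)) :=
  {w | y ∉ C.toSet w.1 (fun i => observe (w.2 i.castSucc)) (cov (w.2 (Fin.last n)))}

theorem measurableSet_missEvent (C : PredictionSet Ω n p) (y : ℝ) :
    MeasurableSet (missEvent C y) := by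
  have hz : ∀ i : Fin (n + 1), Measurable fun w : Ω × (Fin (n + 1) → FullData p) => w.2 i :=
    fun i => (measurable_pi_apply i).comp measurable_snd
  have hf : Measurable fun w : Ω × (Fin (n + 1) → FullData p) =>
      (w.1, (fun i : Fin n => observe (w.2 i.castSucc)), cov (w.2 (Fin.last n)), y) :=
    measurable_fst.prodMk (Measurable.prodMk (measurable_pi_lambda _ fun i : Fin n =>
      measurable_observe.comp (hz i.castSucc))
        ((measurable_cov.comp (hz _)).prodMk measurable_const))
  exact (hf C.measurableSet_graph).compl

theorem measurableSet_mem_atNew (C : PredictionSet Ω n p) :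
    MeasurableSet {q : (Ω × (Fin n → FullData p) × FullData p) × ℝ | q.2 ∈ C.atNew q.1} := by
  have hf : Measurable fun q : (Ω × (Fin n → FullData p) × FullData p) × ℝ =>
      (q.1.1, (fun i : Fin n => observe (q.1.2.1 i)), cov q.1.2.2, q.2) :=
    (measurable_fst.comp measurable_fst).prodMk (Measurable.prodMk
      (measurable_pi_lambda _ fun i : Fin n => measurable_observe.comp
        ((measurable_pi_apply i).comp
          (measurable_fst.comp (measurable_snd.comp measurable_fst))))
      ((measurable_cov.comp (measurable_snd.comp (measurable_snd.comp measurable_fst))).prodMk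
        measurable_snd))
  exact hf C.measurableSet_graph

theorem measurePreserving_splitLast {α : Type*} [MeasurableSpace α] (μ : Measure α)
    [SigmaFinite μ] :
    MeasurePreserving (fun z : Fin (n + 1) → α => ((fun i : Fin n => z i.castSucc), z (Fin.last n)))
      (Measure.pi fun _ => μ) ((Measure.pi fun _ => μ).prod μ) := by
  have h := (Measure.measurePreserving_swap
    (μ := μ) (ν := Measure.pi fun _ : Fin n => μ)).comp
    (measurePreserving_piFinSuccAbove (fun _ : Fin (n + 1) => μ) (Fin.last n))
  convert h using 1
  ext z i
  · simp [MeasurableEquiv.piFinSuccAbove, Fin.init]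
  · simp [MeasurableEquiv.piFinSuccAbove]

theorem missPoint_eq (C : PredictionSet Ω n p) (ν : Measure Ω) [IsProbabilityMeasure ν]
    (P : ProbabilityMeasure (FullData p)) (y : ℝ) :
    C.missPoint ν P y =
      (ν.prod (Measure.pi fun _ : Fin (n + 1) => (P : Measure (FullData p)))) (missEvent C y) := by
  have h := (MeasurePreserving.id ν).prod
    (measurePreserving_splitLast (n := n) (P : Measure (FullData p)))
  have hm : MeasurableSet {w : Ω × (Fin n → FullData p) × FullData p | y ∉ C.atNew w} :=
    ((measurable_id.prodMk measurable_const) (measurableSet_mem_atNew C)).compl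
  exact (h.measure_preimage hm.nullMeasurableSet).symm

theorem missEffect_eq_missPoint (C : PredictionSet Ω n p) (ν : Measure Ω) [IsProbabilityMeasure ν]
    (R : ProbabilityMeasure (FullData p)) (y : ℝ)
    (hR : ∀ᵐ z ∂(R : Measure (FullData p)), effect z = y) :
    C.missEffect ν R = C.missPoint ν R y := by
  have h : ∀ᵐ w ∂experiment ν n R, effect w.2.2 = y :=
    (Measure.quasiMeasurePreserving_snd.comp Measure.quasiMeasurePreserving_snd).ae hR
  refine measure_congr (Filter.eventuallyEq_set.2 ?_)
  filter_upwards [h] with w hw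
  simp only [hw]

/-- The event sees units only through `observe` and `cov`, which `fillOutcome` preserves. -/
theorem missEvent_map_fillOutcome (C : PredictionSet Ω n p) (ν : Measure Ω)
    [IsProbabilityMeasure ν] (μ : Measure (FullData p)) [IsFiniteMeasure μ] (y : ℝ) :
    (ν.prod (Measure.pi fun _ : Fin (n + 1) => μ.map (fillOutcome y))) (missEvent C y) =
      (ν.prod (Measure.pi fun _ : Fin (n + 1) => μ)) (missEvent C y) := by
  have hpi : MeasurePreserving (fun (z : Fin (n + 1) → FullData p) i => fillOutcome y (z i))
      (Measure.pi fun _ => μ) (Measure.pi fun _ => μ.map (fillOutcome y)) :=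
    ⟨measurable_pi_lambda _ fun i => (measurable_fillOutcome y).comp (measurable_pi_apply i),
      Measure.pi_map_pi fun _ => (measurable_fillOutcome y).aemeasurable⟩
  rw [← ((MeasurePreserving.id ν).prod hpi).measure_preimage
    (measurableSet_missEvent C y).nullMeasurableSet]
  congr 1
  ext w
  simp only [missEvent, Set.mem_preimage, Set.mem_ofPred_eq, Prod.map_fst, Prod.map_snd, id,
    observe_fillOutcome]
  rfl

/-! ### Validity for each labelling, then averaging over labellings. -/

section Labels

variable {κ : Type*} [Fintype κ] [MeasurableSpace κ] [MeasurableSingletonClass κ]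
  {k : (Fin p → ℝ) → κ} {P : ProbabilityMeasure (FullData p)} {ν : Measure Ω}
  [IsProbabilityMeasure ν] {C : PredictionSet Ω n p} {a : ENNReal}

/-- Filling in the outcomes and reversing treatment with probability `ε` turns the reweighted law
into a member of `classStr` with effect almost surely `y`, for which missing the effect is missing
`y`. Each of the `n + 1` units costs a factor `1 - ε`. -/
theorem missEvent_labelDensity_le (hk : Measurable k) (hP : P ∈ classE p)
    (hC : ∀ R ∈ classStr p, C.missEffect ν R ≤ a) {A : κ → Bool}
    (hA : ∀ c, labelProb (P : Measure (FullData p)) k c (A c) ≠ 0) (y : ℝ) {ε : ℝ}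
    (h0 : 0 < ε) (h1 : ε ≤ 1 / 2) :
    ENNReal.ofReal (1 - ε) ^ (n + 1) * (ν.prod (Measure.pi fun _ : Fin (n + 1) =>
      (P : Measure (FullData p)).withDensity (labelDensity P k A))) (missEvent C y) ≤ a := by
  have hPA := isProbabilityMeasure_labelDensity (P : Measure (FullData p)) hk hA
  set PA := (P : Measure (FullData p)).withDensity (labelDensity P k A) with hPAdef
  have hac : PA ≪ (P : Measure (FullData p)) := withDensity_absolutelyContinuous _ _
  have hfm : Measurable (fillOutcome y : FullData p → FullData p) := measurable_fillOutcome y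
  have hS : IsProbabilityMeasure (PA.map (fillOutcome y)) :=
    Measure.isProbabilityMeasure_map hfm.aemeasurable
  set S := PA.map (fillOutcome y) with hSdef
  have hN := isProbabilityMeasure_noisyTreat (S := S) h0.le (by linarith : ε ≤ 1)
  let R : ProbabilityMeasure (FullData p) := ⟨noisyTreat ε S, hN⟩
  obtain ⟨⟨j, hj⟩, hy1, hy0⟩ := hP
  have hn1 : ∀ v, PA {z | y1 z = v} = 0 := fun v => hac (by
    have := hy1.measure_singleton v
    rwa [Measure.map_apply measurable_y1 (measurableSet_singleton v)] at this)
  have hn0 : ∀ v, PA {z | y0 z = v} = 0 := fun v => hac (by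
    have := hy0.measure_singleton v
    rwa [Measure.map_apply measurable_y0 (measurableSet_singleton v)] at this)
  have hR : R ∈ classStr p := by
    refine noisyTreat_mem_classStr (S := S) (lab := fun x => A (k x)) h0 h1
      ((measurable_of_finite A).comp hk) ?_ ⟨j, ?_⟩ (fun v => ?_) (fun v => ?_) R rfl
    · have hm : MeasurableSet {z : FullData p | treat z = A (k (cov z))} :=
        measurableSet_eq_fun measurable_treat
          ((measurable_of_finite A).comp (hk.comp measurable_cov))
      rw [hSdef, ae_map_iff hfm.aemeasurable hm]
      exact ae_treat_eq_label (P : Measure (FullData p)) hk A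
    · have hcj : Measurable fun z : FullData p => cov z j :=
        (measurable_pi_apply j).comp measurable_cov
      rw [hSdef, Measure.map_map hcj hfm]
      exact (hac.map hcj).trans hj
    · have hm : MeasurableSet {z : FullData p | y1 z = v} :=
        measurable_y1 (measurableSet_singleton v)
      rw [hSdef, Measure.map_apply hfm hm]
      -- The filled `Y(1)` is `y1` on treated units and `y0 + y` on controls, so an atom would need
      -- an atom of one of the original outcomes.
      refine measure_mono_null (t := {z | y1 z = v} ∪ {z | y0 z = v - y}) (fun z hz => ?_)
        (measure_union_null (hn1 v) (hn0 _))
      have hz' : y1 (fillOutcome y z) = v := hz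
      by_cases h : treat z = true
      · left; simpa [fillOutcome, y1, h] using hz'
      · right
        have : y0 z + y = v := by simpa [fillOutcome, y1, h] using hz'
        exact eq_sub_of_add_eq this
    · have hm : MeasurableSet {z : FullData p | y0 z = v} :=
        measurable_y0 (measurableSet_singleton v)
      rw [hSdef, Measure.map_apply hfm hm]
      refine measure_mono_null (t := {z | y1 z = v + y} ∪ {z | y0 z = v}) (fun z hz => ?_)
        (measure_union_null (hn1 _) (hn0 v))
      have hz' : y0 (fillOutcome y z) = v := hz
      by_cases h : treat z = true
      · left
        have : y1 z - y = v := by simpa [fillOutcome, y0, h] using hz'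
        exact sub_eq_iff_eq_add.1 this
      · right; simpa [fillOutcome, y0, h] using hz'
  have heff : ∀ᵐ z ∂(R : Measure (FullData p)), effect z = y := by
    have hm : MeasurableSet {z : FullData p | ¬ effect z = y} :=
      (measurable_effect (measurableSet_singleton y)).compl
    rw [ae_iff]
    change noisyTreat ε S _ = 0
    rw [noisyTreat_apply_of_invariant h0.le (by linarith) hm rfl, hSdef,
      Measure.map_apply hfm hm]
    simp [effect_fillOutcome]
  have hle : ENNReal.ofReal (1 - ε) • S ≤ noisyTreat ε S := Measure.le_add_right le_rfl
  calc _ = ENNReal.ofReal (1 - ε) ^ (n + 1) *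
        (ν.prod (Measure.pi fun _ : Fin (n + 1) => S)) (missEvent C y) := by
        rw [hSdef, missEvent_map_fillOutcome]
    _ = (ν.prod (Measure.pi fun _ : Fin (n + 1) => ENNReal.ofReal (1 - ε) • S))
          (missEvent C y) := by
        rw [pi_smul S ENNReal.ofReal_ne_top, Measure.prod_smul_right, Measure.smul_apply,
          smul_eq_mul]
    _ ≤ (ν.prod (Measure.pi fun _ : Fin (n + 1) => noisyTreat ε S)) (missEvent C y) := by
        have := Measure.smul_finite S (c := ENNReal.ofReal (1 - ε)) ENNReal.ofReal_ne_top
        exact Measure.prod_mono le_rfl (pi_mono hle) _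
    _ = C.missEffect ν R := by
        rw [missEffect_eq_missPoint C ν R y heff, missPoint_eq]
        rfl
    _ ≤ a := hC R hR

theorem missEvent_inter_injective_mul_le (hk : Measurable k) (hP : P ∈ classE p)
    (hC : ∀ R ∈ classStr p, C.missEffect ν R ≤ a) (y : ℝ) {ε : ℝ}
    (h0 : 0 < ε) (h1 : ε ≤ 1 / 2) :
    ENNReal.ofReal (1 - ε) ^ (n + 1) *
      (ν.prod (Measure.pi fun _ : Fin (n + 1) => (P : Measure (FullData p))))
        (missEvent C y ∩ {w | Function.Injective fun i => k (cov (w.2 i))}) ≤ a := by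
  classical
  set μ := (P : Measure (FullData p))
  set Q := ν.prod (Measure.pi fun _ : Fin (n + 1) => μ)
  have hB := measurableSet_missEvent C y
  have hf : ∀ A : κ → Bool, Measurable (labelDensity μ k A) := measurable_labelDensity μ hk
  have hF : ∀ A : κ → Bool, Measurable fun z : Fin (n + 1) → FullData p =>
      ∏ i, labelDensity μ k A (z i) := fun A =>
    Finset.measurable_fun_prod _ fun i _ => (hf A).comp (measurable_pi_apply i)
  have hlab : ∀ᵐ w ∂Q, ∀ i, labelProb μ k (k (cov (w.2 i))) (treat (w.2 i)) ≠ 0 := by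
    refine ae_all_iff.2 fun i => ?_
    exact ((Measure.quasiMeasurePreserving_eval (fun _ : Fin (n + 1) => μ) i).comp
      Measure.quasiMeasurePreserving_snd).ae (ae_labelProb_ne_zero μ hk)
  have hbound : Q (missEvent C y ∩ {w | Function.Injective fun i => k (cov (w.2 i))}) ≤
      ∑ A : κ → Bool, (∏ c, labelProb μ k c (A c)) *
        ∫⁻ w in missEvent C y, ∏ i, labelDensity μ k A (w.2 i) ∂Q := by
    have hmul : ∀ A : κ → Bool, (∏ c, labelProb μ k c (A c)) *
        ∫⁻ w in missEvent C y, ∏ i, labelDensity μ k A (w.2 i) ∂Q =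
        ∫⁻ w in missEvent C y, (∏ c, labelProb μ k c (A c)) *
          ∏ i, labelDensity μ k A (w.2 i) ∂Q := fun A =>
      (lintegral_const_mul _ ((hF A).comp measurable_snd)).symm
    simp_rw [hmul]
    have hFs : ∀ A : κ → Bool, Measurable fun w : Ω × (Fin (n + 1) → FullData p) =>
        (∏ c, labelProb μ k c (A c)) * ∏ i, labelDensity μ k A (w.2 i) := fun A =>
      ((hF A).comp measurable_snd).const_mul _
    rw [← lintegral_finsetSum _ fun A _ => hFs A, ← setLIntegral_one]
    refine le_trans (lintegral_mono_ae ?_) (lintegral_mono_set Set.inter_subset_left)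
    have hD : MeasurableSet {w : Ω × (Fin (n + 1) → FullData p) |
        Function.Injective fun i => k (cov (w.2 i))} := by
      have : Measurable fun w : Ω × (Fin (n + 1) → FullData p) => fun i => k (cov (w.2 i)) :=
        measurable_pi_lambda _ fun i =>
          (hk.comp measurable_cov).comp ((measurable_pi_apply i).comp measurable_snd)
      exact this (Set.toFinite {g : Fin (n + 1) → κ | Function.Injective g}).measurableSet
    filter_upwards [ae_restrict_of_ae hlab, ae_restrict_mem (hB.inter hD)] with w hw hwD
    exact (sum_prod_labels_eq_one (labelProb μ k) (sum_labelProb μ)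
      (fun i => k (cov (w.2 i))) hwD.2 (fun i => treat (w.2 i)) hw).ge
  have hterm : ∀ A : κ → Bool, ENNReal.ofReal (1 - ε) ^ (n + 1) *
      ((∏ c, labelProb μ k c (A c)) *
        ∫⁻ w in missEvent C y, ∏ i, labelDensity μ k A (w.2 i) ∂Q) ≤
      (∏ c, labelProb μ k c (A c)) * a := by
    intro A
    by_cases hA : ∀ c, labelProb μ k c (A c) ≠ 0
    · have hPA := isProbabilityMeasure_labelDensity μ hk hA
      have := missEvent_labelDensity_le hk hP hC hA y h0 h1
      rw [pi_withDensity μ (hf A), prod_withDensity_right (hF A),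
        withDensity_apply _ hB] at this
      rw [mul_left_comm]
      gcongr
    -- The density may be infinite for such a labelling, but its weight is zero, so both sides
    -- vanish.
    · push Not at hA
      obtain ⟨c, hc⟩ := hA
      have : ∏ c, labelProb μ k c (A c) = 0 := Finset.prod_eq_zero (Finset.mem_univ c) hc
      simp [this]
  calc _ ≤ ENNReal.ofReal (1 - ε) ^ (n + 1) * ∑ A : κ → Bool, (∏ c, labelProb μ k c (A c)) *
        ∫⁻ w in missEvent C y, ∏ i, labelDensity μ k A (w.2 i) ∂Q := by gcongr
    _ ≤ ∑ A : κ → Bool, (∏ c, labelProb μ k c (A c)) * a := by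
        rw [Finset.mul_sum]
        exact Finset.sum_le_sum fun A _ => hterm A
    _ = a := by
        rw [← Finset.sum_mul, ← Fintype.prod_sum]
        simp_rw [sum_labelProb]
        simp

theorem missEvent_inter_injective_le (hk : Measurable k) (hP : P ∈ classE p)
    (hC : ∀ R ∈ classStr p, C.missEffect ν R ≤ a) (y : ℝ) :
    (ν.prod (Measure.pi fun _ : Fin (n + 1) => (P : Measure (FullData p))))
        (missEvent C y ∩ {w | Function.Injective fun i => k (cov (w.2 i))}) ≤ a := by
  set q := (ν.prod (Measure.pi fun _ : Fin (n + 1) => (P : Measure (FullData p))))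
        (missEvent C y ∩ {w | Function.Injective fun i => k (cov (w.2 i))})
  have hq : q ≠ ⊤ := measure_ne_top _ _
  have hlim : Filter.Tendsto (fun m : ℕ => ENNReal.ofReal (1 - 1 / ((m : ℝ) + 1)) ^ (n + 1) * q)
      Filter.atTop (nhds q) := by
    have h1 : Filter.Tendsto (fun m : ℕ => 1 - 1 / ((m : ℝ) + 1)) Filter.atTop (nhds 1) := by
      simpa using tendsto_one_div_add_atTop_nhds_zero_nat.const_sub (1 : ℝ)
    have h2 := ENNReal.Tendsto.pow (n := n + 1) (ENNReal.tendsto_ofReal h1)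
    have h3 := ENNReal.Tendsto.mul_const (b := q) h2 (Or.inr hq)
    simpa using h3
  refine le_of_tendsto hlim ?_
  -- From `m = 1` on, `ε = 1 / (m + 1)` is at most `1 / 2`.
  filter_upwards [Filter.eventually_ge_atTop 1] with m hm
  have hm' : (1 : ℝ) ≤ m := by exact_mod_cast hm
  refine missEvent_inter_injective_mul_le hk hP hC y (by positivity) ?_
  rw [div_le_div_iff₀ (by positivity) (by norm_num)]
  linarith

end Labels

/-! ### Refining the cells, and the infinite length. -/

theorem missPoint_le {P : ProbabilityMeasure (FullData p)} {ν : Measure Ω}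
    [IsProbabilityMeasure ν] {C : PredictionSet Ω n p} {a : ENNReal} (hP : P ∈ classE p)
    (hC : ∀ R ∈ classStr p, C.missEffect ν R ≤ a) (y : ℝ) : C.missPoint ν P y ≤ a := by
  obtain ⟨j, hj⟩ := hP.1
  have hcj : Measurable fun z : FullData p => cov z j :=
    (measurable_pi_apply j).comp measurable_cov
  -- The cell of `x` records the first `M` bits of an injective measurable coding of `x j` by binary
  -- sequences. There are finitely many cells for each `M`, and any two distinct values of the
  -- coordinate are eventually separated.
  let k : (M : ℕ) → (Fin p → ℝ) → Fin M → Bool :=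
    fun M x i => MeasurableSpace.mapNatBool ℝ (x j) i
  have hk : ∀ M, Measurable (k M) := fun M => measurable_pi_lambda _ fun i =>
    (measurable_pi_apply (i : ℕ)).comp
      ((MeasurableSpace.measurable_mapNatBool ℝ).comp (measurable_pi_apply j))
  have hna : NullSingletonClass ((P : Measure (FullData p)).map fun z => cov z j) :=
    ⟨fun x => hj (measure_singleton x)⟩
  rw [missPoint_eq]
  have hB := measurableSet_missEvent C y
  have hD : ∀ M, MeasurableSet {w : Ω × (Fin (n + 1) → FullData p) |
      Function.Injective fun i => k M (cov (w.2 i))} := fun M => by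
    have : Measurable fun w : Ω × (Fin (n + 1) → FullData p) => fun i => k M (cov (w.2 i)) :=
      measurable_pi_lambda _ fun i =>
        ((hk M).comp measurable_cov).comp ((measurable_pi_apply i).comp measurable_snd)
    exact this (Set.toFinite {g : Fin (n + 1) → Fin M → Bool | Function.Injective g}).measurableSet
  have hinj : ∀ᵐ w ∂ν.prod (Measure.pi fun _ : Fin (n + 1) => (P : Measure (FullData p))),
      Function.Injective fun i => cov (w.2 i) j :=
    Measure.quasiMeasurePreserving_snd.ae
      (ae_injective_pi (ι := Fin (n + 1)) (P : Measure (FullData p)) hcj)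
  have hlim := tendsto_measure_of_ae_tendsto_indicator_of_isFiniteMeasure Filter.atTop
    (μ := ν.prod (Measure.pi fun _ : Fin (n + 1) => (P : Measure (FullData p)))) hB
    (fun M => hB.inter (hD M)) (by
      filter_upwards [hinj] with w hw
      have hsep : ∀ i l : Fin (n + 1), i ≠ l →
          ∀ᶠ M in Filter.atTop, k M (cov (w.2 i)) ≠ k M (cov (w.2 l)) := by
        intro i l hil
        have hne : MeasurableSpace.mapNatBool ℝ (cov (w.2 i) j) ≠
            MeasurableSpace.mapNatBool ℝ (cov (w.2 l) j) := fun h =>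
          hil (hw (MeasurableSpace.injective_mapNatBool ℝ h))
        obtain ⟨m, hm⟩ := Function.ne_iff.1 hne
        filter_upwards [Filter.eventually_gt_atTop m] with M hM h
        exact hm (congrFun h ⟨m, hM⟩)
      have hall : ∀ᶠ M in Filter.atTop, ∀ i l : Fin (n + 1), i ≠ l →
          k M (cov (w.2 i)) ≠ k M (cov (w.2 l)) := by
        simp only [Filter.eventually_all]
        exact hsep
      filter_upwards [hall] with M hM
      refine and_iff_left fun i l h => ?_
      by_contra hne
      exact hM i l hne h)
  exact le_of_tendsto' hlim fun M => missEvent_inter_injective_le (hk M) hP hC y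

theorem expectedLength_eq_top {P : ProbabilityMeasure (FullData p)} {ν : Measure Ω}
    [IsProbabilityMeasure ν] {C : PredictionSet Ω n p} {a : ENNReal} (ha : a < 1)
    (h : ∀ y, C.missPoint ν P y ≤ a) : C.expectedLength ν P = ⊤ := by
  have hexp : IsProbabilityMeasure (experiment ν n P) := by unfold experiment; infer_instance
  have hm := measurableSet_mem_atNew C
  -- Tonelli: expected length is the integral over `y` of the coverage probability of `y`, which is
  -- at least `1 - a > 0` everywhere.
  have h1 : C.expectedLength ν P = ∫⁻ y, experiment ν n P {w | y ∈ C.atNew w} := by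
    calc _ = ((experiment ν n P).prod volume) _ := (Measure.prod_apply hm).symm
      _ = _ := Measure.prod_apply_symm hm
  have h2 : ∀ y, 1 - a ≤ experiment ν n P {w | y ∈ C.atNew w} := by
    intro y
    have hmy : MeasurableSet {w | y ∈ C.atNew w} := (measurable_id.prodMk measurable_const) hm
    have := prob_compl_eq_one_sub (μ := experiment ν n P) hmy.compl
    rw [compl_compl] at this
    rw [this]
    exact tsub_le_tsub_left (h y) 1
  rw [h1, eq_top_iff]
  calc (⊤ : ENNReal) = ∫⁻ _ : ℝ, (1 - a) := by
        rw [lintegral_const, Real.volume_univ, ENNReal.mul_top (tsub_pos_of_lt ha).ne']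
    _ ≤ _ := lintegral_mono h2

end ITE

theorem mainTheorem2 {p n : ℕ} {Ω : Type*} [MeasurableSpace Ω]
    (ν : MeasureTheory.Measure Ω) [MeasureTheory.IsProbabilityMeasure ν]
    (C : ITE.PredictionSet Ω n p)
    (𝓟 : Set (MeasureTheory.ProbabilityMeasure (ITE.FullData p)))
    (hClass : 𝓟 = ITE.classOv p ∨ (∃ r : ℝ, 0 < r ∧ 𝓟 = ITE.classMoment p r) ∨ 𝓟 = ITE.classStr p)
    (α : ℝ) (hα : α ∈ Set.Ioo (0 : ℝ) 1)
    (hC : C.FiniteSampleValid ν 𝓟 α)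
    (P : MeasureTheory.ProbabilityMeasure (ITE.FullData p)) (hP : P ∈ ITE.classSI p) :
    (∀ y : ℝ, C.missPoint ν P y ≤ ENNReal.ofReal α) ∧ C.expectedLength ν P = ⊤ := by
  -- The imitating laws all have strong overlap, so validity on the smallest class is all that is
  -- needed.
  have hsub : ITE.classStr p ⊆ 𝓟 := by
    rcases hClass with rfl | ⟨r, hr, rfl⟩ | rfl
    · exact ITE.classStr_subset_classOv
    · exact ITE.classStr_subset_classMoment hr
    · exact subset_rfl
  have hvalid : ∀ R ∈ ITE.classStr p, C.missEffect ν R ≤ ENNReal.ofReal α := fun R hR =>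
    (le_iSup₂ (f := fun R (_ : R ∈ 𝓟) => C.missEffect ν R) R (hsub hR)).trans hC
  have hpoint : ∀ y : ℝ, C.missPoint ν P y ≤ ENNReal.ofReal α := fun y =>
    ITE.missPoint_le hP.1 hvalid y
  exact ⟨hpoint, ITE.expectedLength_eq_top (ENNReal.ofReal_lt_one.2 hα.2) hpoint⟩
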